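/- Let $f:\mathbb{R}^n\to\mathbb{R}^n$ be of class $C^6$ and let $z_0\in\mathbb{R}^n$. For $z\in\mathbb{R}^n$ write $f,f',f'',f'''$ for $f$ and its derivatives at $z$, and define linear maps $A_i(z):\mathbb{R}^n\to\mathbb{R}^n$ by $$A_0w=f'f'w,\quad A_1w=f'f'f'f'w,\quad A_2w=f''(f''(w,f),f),\quad A_3w=f'f'f''(w,f),\quad A_4w=f''(f'f'w,f),$$ $$A_5w=f'f'''(w,f,f),\quad A_6w=f'''(f'w,f,f),\quad A_7w=f''(f'w,f'f),\quad A_8w=f'f''(w,f'f).$$ Consider the one-step method $z_0\mapsto z_1$ with step size $h$ given implicitly by $$z_1=z_0+\Big\{hI-\frac{h^3}{12}A_0+\frac{h^5}{720}\Big[6A_1-A_2+A_3-A_4-\frac32A_5-\frac32A_6+3A_7+3A_8\Big]\Big\}\int_0^1 f(\xi z_1+(1-\xi)z_0)\,d\xi,\qquad(*)$$ where all $A_i$ are evaluated at $\frac{z_0+z_1}{2}$. Then the initial value problem $\dot z=f(z)$, $z(0)=z_0$ has a solution for times near $0$, and the method is well defined for small steps: there are $r,h_0>0$ such that for every real $h$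 with $|h|<h_0$ equation $(*)$ has exactly one solution $z_1=:\Phi_h(z_0)$ in the open ball of radius $r$ about $z_0$. The method is of order six: if $h\mapsto\varphi_h^f(z_0)$ denotes the exact solution of $\dot z=f(z)$, $z(0)=z_0$ near $h=0$, then $$\|\Phi_h(z_0)-\varphi_h^f(z_0)\|=O(h^7)\qquad(h\to0).$$ -/

import Mathlib

open Filter Topology Asymptotics

namespace SixthOrderAVF

noncomputable section

variable {E : Type*} [NormedAddCommGroup E] [NormedSpace ℝ E]

/-- The Jacobian matrix `f'(z)`, as a linear map `w ↦ f'(z) w`. -/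
def J (f : E → E) (z : E) : E →L[ℝ] E := fderiv ℝ f z

/-- The matrix `w ↦ f''(z)(w, u)`, i.e. the second derivative with one slot filled by `u`
(the second derivative is symmetric, so it does not matter which slot is filled). -/
def B (f : E → E) (z u : E) : E →L[ℝ] E := fderiv ℝ (fderiv ℝ f) z u

/-- The matrix `w ↦ f'''(z)(w, u, v)`, i.e. the third derivative with two slots filled by
`u` and `v` (the third derivative is symmetric). -/
def T (f : E → E) (z u v : E) : E →L[ℝ] E := fderiv ℝ (fderiv ℝ (fderiv ℝ f)) z u v

/-- Coefficient matrix of the tall tree with three vertices: `w ↦ f' f' w`. -/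
def A32 (f : E → E) (z : E) : E →L[ℝ] E := J f z ∘L J f z

/-- Coefficient matrix `w ↦ f'''(f' w, f, f)`. -/
def A52 (f : E → E) (z : E) : E →L[ℝ] E := T f z (f z) (f z) ∘L J f z

/-- Coefficient matrix `w ↦ f''(f' w, f' f)`. -/
def A53 (f : E → E) (z : E) : E →L[ℝ] E := B f z (J f z (f z)) ∘L J f z

/-- Coefficient matrix `w ↦ f' f'''(w, f, f)`. -/
def A54 (f : E → E) (z : E) : E →L[ℝ] E := J f z ∘L T f z (f z) (f z)

/-- Coefficient matrix `w ↦ f' f''(w, f' f)`. -/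
def A55 (f : E → E) (z : E) : E →L[ℝ] E := J f z ∘L B f z (J f z (f z))

/-- Coefficient matrix `w ↦ f''(f' f' w, f)`. -/
def A56 (f : E → E) (z : E) : E →L[ℝ] E := B f z (f z) ∘L J f z ∘L J f z

/-- Coefficient matrix `w ↦ f' f' f''(w, f)`. -/
def A57 (f : E → E) (z : E) : E →L[ℝ] E := J f z ∘L J f z ∘L B f z (f z)

/-- Coefficient matrix `w ↦ f' f' f' f' w`. -/
def A58 (f : E → E) (z : E) : E →L[ℝ] E := J f z ∘L J f z ∘L J f z ∘L J f z

/-- Coefficient matrix `w ↦ f''(f''(w, f), f)`. -/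
def A59 (f : E → E) (z : E) : E →L[ℝ] E := B f z (f z) ∘L B f z (f z)

/-- The full coefficient matrix of the method with step `h`, evaluated at the point `z`. -/
def coeffMatrix (f : E → E) (h : ℝ) (z : E) : E →L[ℝ] E :=
  h • ContinuousLinearMap.id ℝ E - (h ^ 3 / 12) • A32 f z
    + (h ^ 5 / 720) • ((6 : ℝ) • A58 f z - A59 f z + A57 f z - A56 f z
        - (3 / 2 : ℝ) • A54 f z - (3 / 2 : ℝ) • A52 f z
        + (3 : ℝ) • A53 f z + (3 : ℝ) • A55 f z)

/-- The average of the vector field over the segment from `z₀` to `z₁`. -/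
def average (f : E → E) (z₀ z₁ : E) : E :=
  ∫ ξ in (0 : ℝ)..1, f (ξ • z₁ + (1 - ξ) • z₀)

/-- `z₁` solves the (implicit) equation of one step of size `h` of the method,
started at `z₀`; the coefficient matrices are evaluated at the midpoint of `z₀` and `z₁`. -/
def IsStep (f : E → E) (h : ℝ) (z₀ z₁ : E) : Prop :=
  z₁ = z₀ + coeffMatrix f h ((1 / 2 : ℝ) • (z₀ + z₁)) (average f z₀ z₁)

/-- `φ` is, for times near `0`, the exact solution of `ż = f(z)`, `z(0) = z₀`. -/
def IsLocalSolution (f : E → E) (z₀ : E) (φ : ℝ → E) : Prop :=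
  φ 0 = z₀ ∧ ∀ᶠ t in 𝓝 (0 : ℝ), HasDerivAt φ (f (φ t)) t

end

end SixthOrderAVF

/-! The proof is consistency plus stability. A step is a fixed point of a map `stepMap f h z₀` whose
Lipschitz constant near `z₀` is `O(|h|)`. For small `h` it is a contraction, which gives existence
and uniqueness. A contraction constant `1/2` also bounds the distance from `Φ h` to any nearby point
by twice the residual of that point, so it is enough to show that the exact solution has residual
`O(h⁷)` (`isBigO_defect`).

For the residual put `h = 2s` and expand about the middle time: `z₀ = φ(s - s)` and `φ(h) = φ(s +
s)`. The midpoint and the slope `(φ(2s) - z₀)/(2s)` are even under reflection of time about `s`,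
hence so are the average of `f` and the matrices at the midpoint. After division by `s`, only the
coefficients of `1`, `s²`, `s⁴` have to vanish. They are not constants but elementary differentials
of `f` at the single moving point `φ(s)`, so they can be compared algebraically.

The time derivatives of `φ` come from iterated Lie derivatives (`timeDeriv_three` to
`timeDeriv_five`). At `s⁴` nine elementary differentials occur, one for each rooted tree with five
vertices. The one with `f''''` cancels between slope and average; the other eight are the vectors
`A_i f`, `i = 1, …, 8`, and the weights of the method cancel them. -/

namespace SixthOrderAVF

/-! ### Taylor estimates with explicit bounds -/

section Taylor

variable {E F : Type*} [NormedAddCommGroup E] [NormedSpace ℝ E]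
  [NormedAddCommGroup F] [NormedSpace ℝ F]

/-- Taylor's formula for a chain of functions each of which is the derivative of the previous
one. -/
theorem norm_sub_taylor_sum_le {n : ℕ} {u : ℕ → ℝ → F} {C r : ℝ}
    (hu : ∀ k < n, ∀ t, |t| ≤ r → HasDerivAt (u k) (u (k + 1) t) t)
    (hC : ∀ t, |t| ≤ r → ‖u n t‖ ≤ C) {t : ℝ} (ht : |t| ≤ r) :
    ‖u 0 t - ∑ k ∈ Finset.range n, (t ^ k / (k.factorial : ℝ)) • u k 0‖ ≤ C * |t| ^ n := by
  induction n generalizing u t with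
  | zero => simpa using hC t ht
  | succ n ih =>
    have hr : 0 ≤ r := (abs_nonneg t).trans ht
    have hC0 : 0 ≤ C := (norm_nonneg _).trans (hC 0 (by simpa using hr))
    have key : ∀ x, |x| ≤ r →
        ‖u 1 x - ∑ k ∈ Finset.range n, (x ^ k / (k.factorial : ℝ)) • u (k + 1) 0‖ ≤
          C * |x| ^ n := fun x hx =>
      ih (u := fun k => u (k + 1)) (fun k hk t ht => hu (k + 1) (by lia) t ht) hC hx
    have hder : ∀ x ∈ Set.Icc (-|t|) |t|, HasDerivWithinAt
        (fun y => u 0 y - ∑ k ∈ Finset.range (n + 1), (y ^ k / (k.factorial : ℝ)) • u k 0)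
        (u 1 x - ∑ k ∈ Finset.range n, (x ^ k / (k.factorial : ℝ)) • u (k + 1) 0)
        (Set.Icc (-|t|) |t|) x := by
      intro x hx
      refine HasDerivAt.hasDerivWithinAt ?_
      refine (hu 0 (by lia) x ((abs_le.2 hx).trans ht)).sub ?_
      simp_rw [Finset.sum_range_succ']
      have h1 : ∀ k ∈ Finset.range n, HasDerivAt
          (fun y : ℝ => (y ^ (k + 1) / ((k + 1).factorial : ℝ)) • u (k + 1) 0)
          ((x ^ k / (k.factorial : ℝ)) • u (k + 1) 0) x := by
        intro k _
        refine HasDerivAt.smul_const ?_ _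
        convert (hasDerivAt_pow (k + 1) x).div_const ((k + 1).factorial : ℝ) using 1
        have : (k.factorial : ℝ) ≠ 0 := by positivity
        have : (k : ℝ) + 1 ≠ 0 := by positivity
        simp only [Nat.factorial_succ, Nat.cast_mul, Nat.cast_add, Nat.cast_one,
          Nat.add_sub_cancel]
        field_simp
      have h2 := (HasDerivAt.fun_sum h1).add_const (((1 : ℝ) / ((0 : ℕ).factorial : ℝ)) • u 0 0)
      simpa using h2
    -- The mean value inequality on the symmetric interval treats both signs of `t` at once.
    -- Bounding the derivative by its largest value loses the factor `1/n!`, which is not needed.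
    have := Convex.norm_image_sub_le_of_norm_hasDerivWithin_le (C := C * |t| ^ n) hder
      (fun x hx => (key x ((abs_le.2 hx).trans ht)).trans (by
        have : |x| ≤ |t| := abs_le.2 hx
        gcongr)) (convex_Icc _ _) (x := 0) (y := t) (by simp) (abs_le.1 le_rfl)
    have h0 : u 0 0 - ∑ k ∈ Finset.range (n + 1), ((0 : ℝ) ^ k / (k.factorial : ℝ)) • u k 0
        = 0 := by
      simp [Finset.sum_range_succ']
    simp only [h0, sub_zero, Real.norm_eq_abs] at this
    calc _ ≤ C * |t| ^ n * |t| := this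
      _ = _ := by ring

theorem hasDerivAt_iteratedFDeriv_line {n k : ℕ} {g : E → F} (hg : ContDiff ℝ n g) (hk : k < n)
    (x v : E) (t : ℝ) :
    HasDerivAt (fun τ : ℝ => iteratedFDeriv ℝ k g (x + τ • v) (fun _ => v))
      (iteratedFDeriv ℝ (k + 1) g (x + t • v) (fun _ => v)) t := by
  have h1 : HasDerivAt (fun τ : ℝ => x + τ • v) v t := by
    simpa using ((hasDerivAt_id t).smul_const v).const_add x
  have h2 : HasFDerivAt (iteratedFDeriv ℝ k g) (fderiv ℝ (iteratedFDeriv ℝ k g) (x + t • v))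
      (x + t • v) :=
    ((hg.differentiable_iteratedFDeriv (by exact_mod_cast hk)) _).hasFDerivAt
  have h3 := h2.comp_hasDerivAt t h1
  have h4 := (ContinuousMultilinearMap.apply ℝ (fun _ : Fin k => E) F
    (fun _ => v)).hasFDerivAt.comp_hasDerivAt t h3
  exact h4

/-- Taylor's formula along segments, uniformly in the base point near `z`. -/
theorem exists_norm_sub_taylor_sum_le {n : ℕ} {g : E → F} (hg : ContDiff ℝ n g) (z : E) :
    ∃ C, 0 ≤ C ∧ ∃ δ > 0, ∀ x v : E, ‖x - z‖ < δ → ‖v‖ < δ → ∀ t : ℝ, |t| ≤ 1 →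
      ‖g (x + t • v) - ∑ k ∈ Finset.range n,
        (t ^ k / (k.factorial : ℝ)) • iteratedFDeriv ℝ k g x (fun _ => v)‖ ≤ C * ‖v‖ ^ n := by
  have hc : Continuous fun x => ‖iteratedFDeriv ℝ n g x‖ :=
    (hg.continuous_iteratedFDeriv le_rfl).norm
  have hb : ∀ᶠ x in 𝓝 z, ‖iteratedFDeriv ℝ n g x‖ < ‖iteratedFDeriv ℝ n g z‖ + 1 :=
    hc.continuousAt.eventually_lt continuousAt_const (by simp)
  obtain ⟨ε, hε, hball⟩ := Metric.eventually_nhds_iff_ball.1 hb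
  -- Half the radius, so that the whole segment from `x - v` to `x + v` stays in the ball where the
  -- derivative is bounded.
  refine ⟨‖iteratedFDeriv ℝ n g z‖ + 1, by positivity, ε / 2, by positivity, ?_⟩
  intro x v hx hv t ht
  have := norm_sub_taylor_sum_le (n := n) (r := 1)
    (u := fun k τ => iteratedFDeriv ℝ k g (x + τ • v) (fun _ => v))
    (C := (‖iteratedFDeriv ℝ n g z‖ + 1) * ‖v‖ ^ n)
    (fun k hk t _ => hasDerivAt_iteratedFDeriv_line hg hk x v t) (fun τ hτ => ?_) ht
  · simp only [iteratedFDeriv_zero_apply, zero_smul, add_zero] at this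
    refine this.trans (mul_le_of_le_one_right (by positivity) (pow_le_one₀ (abs_nonneg _) ht))
  · have h1 : ‖x + τ • v - z‖ < ε := by
      have h2 : ‖τ • v‖ ≤ ‖v‖ := by
        rw [norm_smul]
        exact mul_le_of_le_one_left (norm_nonneg _) hτ
      calc ‖x + τ • v - z‖ = ‖(x - z) + τ • v‖ := by congr 1; abel
        _ ≤ ‖x - z‖ + ‖τ • v‖ := norm_add_le _ _
        _ < ε := by linarith
    have h3 := (hball _ (by simpa [dist_eq_norm] using h1)).le
    refine (ContinuousMultilinearMap.le_opNorm _ _).trans ?_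
    simp only [Finset.prod_const, Finset.card_univ, Fintype.card_fin]
    gcongr

theorem iteratedFDeriv_four_apply (g : E → F) (z v : E) :
    iteratedFDeriv ℝ 4 g z (fun _ => v) =
      fderiv ℝ (fderiv ℝ (fderiv ℝ (fderiv ℝ g))) z v v v v := by
  rw [iteratedFDeriv_succ_apply_right, iteratedFDeriv_succ_apply_right,
    iteratedFDeriv_two_apply]
  rfl

end Taylor

/-! ### Calculus of even expansions modulo `s⁶` -/

theorem isBigO_comp_of_continuous {F G : Type*} [NormedAddCommGroup F] [NormedAddCommGroup G]
    {c : ℝ → F} {z : F} (hc : Tendsto c (𝓝[≠] 0) (𝓝 z))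
    {g : F → G} (hg : Continuous g) : (fun s => g (c s)) =O[𝓝[≠] 0] fun s => s ^ 0 := by
  simpa using ((hg.tendsto z).comp hc).isBigO_one ℝ

section Expansion

variable {E F G : Type*} [NormedAddCommGroup E] [NormedSpace ℝ E]
  [NormedAddCommGroup F] [NormedSpace ℝ F] [NormedAddCommGroup G] [NormedSpace ℝ G]

theorem isBigO_clm_apply {α : Type*} {l : Filter α} {L : α → F →L[ℝ] G} {v : α → F}
    {a b : α → ℝ} (hL : L =O[l] a) (hv : v =O[l] b) :
    (fun s => L s (v s)) =O[l] fun s => a s * b s :=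
  (IsBigO.of_norm_le (g := fun s => ‖L s‖ * ‖v s‖) fun s => (L s).le_opNorm (v s)).trans
    (hL.norm_left.mul hv.norm_left)

theorem isBigO_pow_pow {m n : ℕ} (h : m ≤ n) :
    (fun s : ℝ => s ^ n) =O[𝓝[≠] 0] fun s => s ^ m := by
  rcases h.eq_or_lt with rfl | h
  · exact isBigO_refl _ _
  · exact (isLittleO_pow_pow h).isBigO.mono nhdsWithin_le_nhds

theorem isBigO_pow_smul {X : ℝ → F} {m n : ℕ} (hX : X =O[𝓝[≠] 0] fun s => s ^ m) :
    (fun s => s ^ n • X s) =O[𝓝[≠] 0] fun s => s ^ (n + m) := by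
  simpa only [pow_add, smul_eq_mul] using
    (isBigO_refl (fun s : ℝ => s ^ n) (𝓝[≠] 0)).smul hX

/-- `X s = X₀ s + s² X₁ s + s⁴ X₂ s + O(s⁶)` as `s → 0`, `s ≠ 0`, with bounded coefficients. -/
structure EvenExpansion (X X₀ X₁ X₂ : ℝ → F) : Prop where
  zero : X₀ =O[𝓝[≠] 0] fun s => s ^ 0
  one : X₁ =O[𝓝[≠] 0] fun s => s ^ 0
  two : X₂ =O[𝓝[≠] 0] fun s => s ^ 0
  rem : (fun s => X s - (X₀ s + s ^ 2 • X₁ s + s ^ 4 • X₂ s)) =O[𝓝[≠] 0] fun s => s ^ 6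

namespace EvenExpansion

variable {X X₀ X₁ X₂ Y Y₀ Y₁ Y₂ : ℝ → F} {L L₀ L₁ L₂ : ℝ → F →L[ℝ] G}

theorem main_isBigO (h : EvenExpansion X X₀ X₁ X₂) :
    (fun s => X₀ s + s ^ 2 • X₁ s + s ^ 4 • X₂ s) =O[𝓝[≠] 0] fun s => s ^ 0 :=
  (h.zero.add ((isBigO_pow_smul h.one).trans (isBigO_pow_pow (by lia)))).add
    ((isBigO_pow_smul h.two).trans (isBigO_pow_pow (by lia)))

theorem isBigO (h : EvenExpansion X X₀ X₁ X₂) : X =O[𝓝[≠] 0] fun s => s ^ 0 := by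
  simpa using (h.rem.trans (isBigO_pow_pow (Nat.zero_le 6))).add h.main_isBigO

theorem const (h : X =O[𝓝[≠] 0] fun s => s ^ 0) : EvenExpansion X X 0 0 :=
  ⟨h, isBigO_zero _ _, isBigO_zero _ _, by simpa using isBigO_zero _ _⟩

theorem congr_of_isBigO (h : EvenExpansion X X₀ X₁ X₂)
    (hY : (fun s => Y s - X s) =O[𝓝[≠] 0] fun s => s ^ 6) : EvenExpansion Y X₀ X₁ X₂ :=
  ⟨h.zero, h.one, h.two, by simpa using hY.add h.rem⟩

theorem add (hX : EvenExpansion X X₀ X₁ X₂) (hY : EvenExpansion Y Y₀ Y₁ Y₂) :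
    EvenExpansion (fun s => X s + Y s) (fun s => X₀ s + Y₀ s) (fun s => X₁ s + Y₁ s)
      (fun s => X₂ s + Y₂ s) :=
  ⟨hX.zero.add hY.zero, hX.one.add hY.one, hX.two.add hY.two,
    (hX.rem.add hY.rem).congr_left fun s => by module⟩

theorem const_smul (a : ℝ) (hX : EvenExpansion X X₀ X₁ X₂) :
    EvenExpansion (fun s => a • X s) (fun s => a • X₀ s) (fun s => a • X₁ s)
      (fun s => a • X₂ s) :=
  ⟨hX.zero.const_smul_left a, hX.one.const_smul_left a, hX.two.const_smul_left a,
    (hX.rem.const_smul_left a).congr_left fun s => by simp only [Pi.smul_apply]; module⟩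

theorem sq_smul (hX : EvenExpansion X X₀ X₁ X₂) :
    EvenExpansion (fun s => s ^ 2 • X s) 0 X₀ X₁ := by
  refine ⟨isBigO_zero _ _, hX.zero, hX.one, ?_⟩
  have h1 := (isBigO_pow_smul (n := 2) hX.rem).trans (isBigO_pow_pow (show 6 ≤ 2 + 6 by lia))
  refine (h1.add (isBigO_pow_smul (n := 6) hX.two)).congr_left fun s => ?_
  simp only [Pi.zero_apply]
  module

theorem clm_apply (hL : EvenExpansion L L₀ L₁ L₂) (hX : EvenExpansion X X₀ X₁ X₂) :
    EvenExpansion (fun s => L s (X s)) (fun s => L₀ s (X₀ s))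
      (fun s => L₀ s (X₁ s) + L₁ s (X₀ s))
      (fun s => L₀ s (X₂ s) + L₁ s (X₁ s) + L₂ s (X₀ s)) := by
  have b {M : ℝ → F →L[ℝ] G} {Z : ℝ → F} (hM : M =O[𝓝[≠] 0] fun s => s ^ 0)
      (hZ : Z =O[𝓝[≠] 0] fun s => s ^ 0) :
      (fun s => M s (Z s)) =O[𝓝[≠] 0] fun s => s ^ 0 := by
    simpa using isBigO_clm_apply hM hZ
  refine ⟨b hL.zero hX.zero, (b hL.zero hX.one).add (b hL.one hX.zero),
    ((b hL.zero hX.two).add (b hL.one hX.one)).add (b hL.two hX.zero), ?_⟩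
  -- The error of the product: the remainder of `L` on `X`, the main part of `L` on the remainder of
  -- `X`, the cross terms at `s⁶`, and the term at `s⁸`.
  have h1 := isBigO_clm_apply hL.rem hX.isBigO
  have h2 := isBigO_clm_apply hL.main_isBigO hX.rem
  have h3 := isBigO_pow_smul (n := 6) ((b hL.one hX.two).add (b hL.two hX.one))
  have h4 := (isBigO_pow_smul (n := 8) (b hL.two hX.two)).trans
    (isBigO_pow_pow (show 6 ≤ 8 + 0 by lia))
  simp only [pow_zero, mul_one, one_mul, add_zero] at h1 h2 h3 h4
  refine (((h1.add h2).add h3).add h4).congr_left fun s => ?_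
  simp only [_root_.sub_apply, _root_.add_apply, map_sub, map_add,
    _root_.smul_apply, map_smul]
  module

theorem isBigO_sq {m m₁ m₂ : ℝ → F} (hm : EvenExpansion m 0 m₁ m₂) :
    m =O[𝓝[≠] 0] fun s => s ^ 2 := by
  have h1 := hm.rem.trans (isBigO_pow_pow (show 2 ≤ 6 by lia))
  have h2 := isBigO_pow_smul (n := 2) hm.one
  have h3 := (isBigO_pow_smul (n := 4) hm.two).trans (isBigO_pow_pow (show 2 ≤ 4 + 0 by lia))
  refine ((h1.add h2).add h3).congr_left fun s => ?_
  simp only [Pi.zero_apply]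
  abel

theorem tendsto_zero {m m₁ m₂ : ℝ → F} (hm : EvenExpansion m 0 m₁ m₂) :
    Tendsto m (𝓝[≠] 0) (𝓝 0) := by
  refine hm.isBigO_sq.trans_tendsto ?_
  have : Tendsto (fun s : ℝ => s ^ 2) (𝓝 0) (𝓝 (0 ^ 2)) := (continuous_pow 2).tendsto 0
  simpa using this.mono_left (nhdsWithin_le_nhds (s := {0}ᶜ))

/-- Behind the factor `s⁴` the shift `m = O(s²)` matters only at order `s⁶`, so local Lipschitz
continuity of `g` replaces a Taylor expansion. -/
theorem pow_four_smul_comp_contDiff {g : F → G} (hg : ContDiff ℝ 1 g) {c m m₁ m₂ : ℝ → F} {z : F}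
    (hc : Tendsto c (𝓝[≠] 0) (𝓝 z)) (hm : EvenExpansion m 0 m₁ m₂) :
    EvenExpansion (fun s => s ^ 4 • g (c s + m s)) 0 0 (fun s => g (c s)) := by
  refine ⟨isBigO_zero _ _, isBigO_zero _ _, isBigO_comp_of_continuous hc hg.continuous, ?_⟩
  obtain ⟨K, t, ht, hK⟩ := hg.contDiffAt.exists_lipschitzOnWith (x := z)
  have hcm : Tendsto (fun s => c s + m s) (𝓝[≠] 0) (𝓝 z) := by
    simpa using hc.add hm.tendsto_zero
  have h1 : (fun s => g (c s + m s) - g (c s)) =O[𝓝[≠] 0] m := by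
    refine IsBigO.of_bound K ?_
    filter_upwards [hc ht, hcm ht] with s h1 h2
    simpa using hK.norm_sub_le h2 h1
  refine (isBigO_pow_smul (n := 4) (h1.trans hm.isBigO_sq)).congr_left fun s => ?_
  simp only [Pi.zero_apply]
  module

theorem pow_four_smul_fderiv_apply {g : F → G} (hg : ContDiff ℝ 2 g) {c m m₁ m₂ : ℝ → F} {z : F}
    (hc : Tendsto c (𝓝[≠] 0) (𝓝 z)) (hm : EvenExpansion m 0 m₁ m₂)
    (hX : EvenExpansion X X₀ X₁ X₂) :
    EvenExpansion (fun s => s ^ 4 • fderiv ℝ g (c s + m s) (X s)) 0 0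
      (fun s => fderiv ℝ g (c s) (X₀ s)) := by
  simpa [Pi.zero_def] using
    (pow_four_smul_comp_contDiff (hg.fderiv_right (by norm_num)) hc hm).clm_apply hX

/-- Composition with a `C³` map, at points of the form `c s + m s` with `m s = O(s²)`. -/
theorem comp_contDiff {g : F → G} (hg : ContDiff ℝ 3 g) {c m m₁ m₂ : ℝ → F} {z : F}
    (hc : Tendsto c (𝓝[≠] 0) (𝓝 z)) (hm : EvenExpansion m 0 m₁ m₂) :
    EvenExpansion (fun s => g (c s + m s)) (fun s => g (c s)) (fun s => fderiv ℝ g (c s) (m₁ s))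
      (fun s => fderiv ℝ g (c s) (m₂ s)
        + (1 / 2 : ℝ) • fderiv ℝ (fderiv ℝ g) (c s) (m₁ s) (m₁ s)) := by
  have hg1 : ContDiff ℝ 2 (fderiv ℝ g) := hg.fderiv_right (by norm_num)
  have hg2 : ContDiff ℝ 1 (fderiv ℝ (fderiv ℝ g)) := hg1.fderiv_right (by norm_num)
  have e0 := const (isBigO_comp_of_continuous hc hg.continuous)
  have e1 := (const (isBigO_comp_of_continuous hc hg1.continuous)).clm_apply hm
  have e2 := (((const (isBigO_comp_of_continuous hc hg2.continuous)).clm_apply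
    hm).clm_apply hm).const_smul (1 / 2)
  have hm2 := hm.isBigO_sq
  have hm0 := hm.tendsto_zero
  have key : (fun s => g (c s + m s) - (g (c s) + fderiv ℝ g (c s) (m s)
      + (1 / 2 : ℝ) • fderiv ℝ (fderiv ℝ g) (c s) (m s) (m s))) =O[𝓝[≠] 0]
        fun s => s ^ 6 := by
    obtain ⟨C, hC, δ, hδ, h⟩ := exists_norm_sub_taylor_sum_le (n := 3) hg z
    have h1 : ∀ᶠ s in 𝓝[≠] 0, ‖c s - z‖ < δ := by
      simpa [dist_eq_norm] using hc.eventually (Metric.ball_mem_nhds z hδ)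
    have h2 : ∀ᶠ s in 𝓝[≠] 0, ‖m s‖ < δ := by
      simpa [dist_eq_norm] using hm0.eventually (Metric.ball_mem_nhds 0 hδ)
    -- Since `m = O(s²)`, the cubic Taylor remainder is already `O(s⁶)`.
    refine IsBigO.trans (g := fun s => ‖m s‖ ^ 3) (IsBigO.of_bound C ?_) ?_
    · filter_upwards [h1, h2] with s hs1 hs2
      have := h _ _ hs1 hs2 1 (by simp)
      rw [Real.norm_of_nonneg (by positivity : 0 ≤ ‖m s‖ ^ 3)]
      simpa [Finset.sum_range_succ, iteratedFDeriv_two_apply, Nat.factorial] using this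
    · simpa only [← pow_mul] using hm2.norm_left.pow 3
  have := ((e0.add e1).add e2).congr_of_isBigO key
  simpa using this

end EvenExpansion

end Expansion

/-! ### Time derivatives of a solution as elementary differentials -/

section LieDerivative

variable {E F G : Type*} [NormedAddCommGroup E] [NormedSpace ℝ E]
  [NormedAddCommGroup F] [NormedSpace ℝ F] [NormedAddCommGroup G] [NormedSpace ℝ G]

/-- The derivative of `g` along the vector field `f`. -/
noncomputable def lie (f : E → E) (g : E → F) (z : E) : F := fderiv ℝ g z (f z)

/-- The `k`-th time derivative of a solution of `ż = f(z)`, as a function of the position. -/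
noncomputable def timeDeriv (f : E → E) : ℕ → E → E
  | 0 => id
  | k + 1 => lie f (timeDeriv f k)

/-- The first time derivative is `f` itself, so the `k`-th one uses only `k - 1` derivatives of `f`.
For `f` of class `C⁶` the seventh is still continuous, which is what a remainder `O(s⁷)` requires.
-/
theorem contDiff_timeDeriv {f : E → E} {n : ℕ} (hf : ContDiff ℝ n f) {k m : ℕ}
    (h : k + m ≤ n + 1) : ContDiff ℝ m (timeDeriv f k) := by
  induction k generalizing m with
  | zero => exact contDiff_id
  | succ k ih =>
    cases k with
    | zero =>
      have : timeDeriv f 1 = f := by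
        funext z
        simp [timeDeriv, lie]
      rw [this]
      exact hf.of_le (by exact_mod_cast (by lia : m ≤ n))
    | succ k =>
      exact ((ih (m := m + 1) (by lia)).fderiv_right (by norm_cast)).clm_apply
        (hf.of_le (by exact_mod_cast (by lia : m ≤ n)))

theorem hasDerivAt_comp_solution {f : E → E} {g : E → F} {φ : ℝ → E} {t : ℝ}
    (hφ : HasDerivAt φ (f (φ t)) t) (hg : DifferentiableAt ℝ g (φ t)) :
    HasDerivAt (fun s => g (φ s)) (lie f g (φ t)) t :=
  hg.hasFDerivAt.comp_hasDerivAt t hφ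

theorem lie_clm_apply {f : E → E} {L : E → F →L[ℝ] G} {v : E → F} (hL : Differentiable ℝ L)
    (hv : Differentiable ℝ v) :
    lie f (fun y => L y (v y)) = fun y => lie f L y (v y) + L y (lie f v y) := by
  funext z
  simp [lie, fderiv_clm_apply (hL z) (hv z), add_comm]

theorem lie_add {f : E → E} {u v : E → F} (hu : Differentiable ℝ u)
    (hv : Differentiable ℝ v) :
    lie f (fun y => u y + v y) = fun y => lie f u y + lie f v y := by
  funext z
  simp [lie, fderiv_fun_add (hu z) (hv z)]

theorem lie_const_smul {f : E → E} {u : E → F} (a : ℝ) (hu : Differentiable ℝ u) :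
    lie f (fun y => a • u y) = fun y => a • lie f u y := by
  funext z
  simp [lie, fderiv_fun_const_smul (hu z)]

variable {f : E → E}

theorem timeDeriv_zero : timeDeriv f 0 = id := rfl

theorem timeDeriv_one : timeDeriv f 1 = f := by
  funext z
  simp [timeDeriv, lie]

theorem timeDeriv_two : timeDeriv f 2 = fun z => fderiv ℝ f z (f z) := by
  rw [timeDeriv, timeDeriv_one]
  rfl

theorem timeDeriv_three (hf : ContDiff ℝ 2 f) : timeDeriv f 3 = fun z =>
    fderiv ℝ (fderiv ℝ f) z (f z) (f z) + fderiv ℝ f z (fderiv ℝ f z (f z)) := by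
  have hf1 : ContDiff ℝ 1 (fderiv ℝ f) := hf.fderiv_right (by norm_num)
  rw [timeDeriv, timeDeriv_two, lie_clm_apply (hf1.differentiable (by norm_num))
    (hf.differentiable (by norm_num))]
  rfl

theorem fderiv_fderiv_symm {g : E → F} (hg : ContDiff ℝ 2 g) (z u v : E) :
    fderiv ℝ (fderiv ℝ g) z u v = fderiv ℝ (fderiv ℝ g) z v u :=
  (hg.contDiffAt.isSymmSndFDerivAt (by simp)) u v

/-- Differentiating the symmetry of the second derivative gives symmetry in the last two slots; for
the first two, `fderiv_fderiv_symm` applies to `fderiv ℝ g`. -/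
theorem fderiv_fderiv_fderiv_symm {g : E → F} (hg : ContDiff ℝ 3 g) (z u v w : E) :
    fderiv ℝ (fderiv ℝ (fderiv ℝ g)) z u v w = fderiv ℝ (fderiv ℝ (fderiv ℝ g)) z u w v := by
  have hg1 : ContDiff ℝ 2 (fderiv ℝ g) := hg.fderiv_right (by norm_num)
  have hg2 : Differentiable ℝ (fderiv ℝ (fderiv ℝ g)) :=
    (hg1.fderiv_right (m := 1) (by norm_num)).differentiable (by norm_num)
  have h (v w : E) : fderiv ℝ (fun y => fderiv ℝ (fderiv ℝ g) y v w) z u =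
      fderiv ℝ (fderiv ℝ (fderiv ℝ g)) z u v w := by
    rw [fderiv_clm_apply (by fun_prop) (by fun_prop), fderiv_clm_apply (by fun_prop) (by fun_prop)]
    simp
  rw [← h, ← h]
  simp_rw [fderiv_fderiv_symm (hg.of_le (by norm_num)) _ v w]

theorem timeDeriv_four (hf : ContDiff ℝ 3 f) : timeDeriv f 4 = fun z =>
    fderiv ℝ (fderiv ℝ (fderiv ℝ f)) z (f z) (f z) (f z)
      + (3 : ℝ) • fderiv ℝ (fderiv ℝ f) z (fderiv ℝ f z (f z)) (f z)
      + fderiv ℝ f z (fderiv ℝ (fderiv ℝ f) z (f z) (f z))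
      + fderiv ℝ f z (fderiv ℝ f z (fderiv ℝ f z (f z))) := by
  have hf1 : ContDiff ℝ 2 (fderiv ℝ f) := hf.fderiv_right (by norm_num)
  have hf2 : ContDiff ℝ 1 (fderiv ℝ (fderiv ℝ f)) := hf1.fderiv_right (by norm_num)
  have d0 : Differentiable ℝ f := hf.differentiable (by norm_num)
  have d1 : Differentiable ℝ (fderiv ℝ f) := hf1.differentiable (by norm_num)
  have d2 : Differentiable ℝ (fderiv ℝ (fderiv ℝ f)) := hf2.differentiable (by norm_num)
  rw [timeDeriv, timeDeriv_three (hf.of_le (by norm_num)), lie_add (by fun_prop) (by fun_prop),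
    lie_clm_apply (by fun_prop) (by fun_prop), lie_clm_apply (by fun_prop) (by fun_prop),
    lie_clm_apply (by fun_prop) (by fun_prop), lie_clm_apply (by fun_prop) (by fun_prop)]
  funext z
  simp only [lie]
  rw [fderiv_fderiv_symm (hf.of_le (by norm_num)) z (f z) (fderiv ℝ f z (f z))]
  simp only [_root_.add_apply, map_add]
  module

/-- One term for each rooted tree with five vertices. The coefficients count the increasing
labellings of the trees and add up to `4! = 24`. Symmetry of the derivatives is what allows equal
trees to be collected. -/
theorem timeDeriv_five (hf : ContDiff ℝ 4 f) : timeDeriv f 5 = fun z =>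
    fderiv ℝ (fderiv ℝ (fderiv ℝ (fderiv ℝ f))) z (f z) (f z) (f z) (f z)
      + (6 : ℝ) • fderiv ℝ (fderiv ℝ (fderiv ℝ f)) z (f z) (f z) (fderiv ℝ f z (f z))
      + (4 : ℝ) • fderiv ℝ (fderiv ℝ f) z (f z) (fderiv ℝ (fderiv ℝ f) z (f z) (f z))
      + (4 : ℝ) • fderiv ℝ (fderiv ℝ f) z (f z) (fderiv ℝ f z (fderiv ℝ f z (f z)))
      + (3 : ℝ) • fderiv ℝ (fderiv ℝ f) z (fderiv ℝ f z (f z)) (fderiv ℝ f z (f z))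
      + fderiv ℝ f z (fderiv ℝ (fderiv ℝ (fderiv ℝ f)) z (f z) (f z) (f z))
      + (3 : ℝ) • fderiv ℝ f z (fderiv ℝ (fderiv ℝ f) z (fderiv ℝ f z (f z)) (f z))
      + fderiv ℝ f z (fderiv ℝ f z (fderiv ℝ (fderiv ℝ f) z (f z) (f z)))
      + fderiv ℝ f z (fderiv ℝ f z (fderiv ℝ f z (fderiv ℝ f z (f z)))) := by
  have hf1 : ContDiff ℝ 3 (fderiv ℝ f) := hf.fderiv_right (by norm_num)
  have hf2 : ContDiff ℝ 2 (fderiv ℝ (fderiv ℝ f)) := hf1.fderiv_right (by norm_num)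
  have hf3 : ContDiff ℝ 1 (fderiv ℝ (fderiv ℝ (fderiv ℝ f))) := hf2.fderiv_right (by norm_num)
  have d0 : Differentiable ℝ f := hf.differentiable (by norm_num)
  have d1 : Differentiable ℝ (fderiv ℝ f) := hf1.differentiable (by norm_num)
  have d2 : Differentiable ℝ (fderiv ℝ (fderiv ℝ f)) := hf2.differentiable (by norm_num)
  have d3 : Differentiable ℝ (fderiv ℝ (fderiv ℝ (fderiv ℝ f))) :=
    hf3.differentiable (by norm_num)
  rw [timeDeriv, timeDeriv_four (hf.of_le (by norm_num))]
  iterate 3 rw [lie_add (by fun_prop) (by fun_prop)]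
  rw [lie_const_smul _ (by fun_prop)]
  iterate 12 rw [lie_clm_apply (by fun_prop) (by fun_prop)]
  funext z
  have s2 := fderiv_fderiv_symm (hf.of_le (by norm_num : (2 : WithTop ℕ∞) ≤ 4)) z
  have s3 := fderiv_fderiv_symm (hf1.of_le (by norm_num : (2 : WithTop ℕ∞) ≤ 3)) z
  have s3' := fderiv_fderiv_fderiv_symm (hf.of_le (by norm_num : (3 : WithTop ℕ∞) ≤ 4)) z
  simp only [lie]
  simp only [_root_.add_apply, map_add]
  rw [s3 (fderiv ℝ f z (f z)) (f z), s3' (f z) (fderiv ℝ f z (f z)) (f z),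
    s2 (fderiv ℝ (fderiv ℝ f) z (f z) (f z)) (f z),
    s2 (fderiv ℝ f z (fderiv ℝ f z (f z))) (f z),
    s2 (f z) (fderiv ℝ f z (f z))]
  module

end LieDerivative

/-! ### Consistency: the residual of the exact solution -/

section Method

variable {E : Type*} [NormedAddCommGroup E] [NormedSpace ℝ E] {f : E → E}

theorem isBigO_solution_sub_taylor (hf : ContDiff ℝ 6 f) {z₀ : E} {φ : ℝ → E}
    (hφ : IsLocalSolution f z₀ φ) {a : ℝ} (ha : |a| ≤ 1) :
    (fun s => φ (s + a * s) - ∑ k ∈ Finset.range 7,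
      ((a * s) ^ k / (k.factorial : ℝ)) • timeDeriv f k (φ s)) =O[𝓝 0] fun s => s ^ 7 := by
  have hφ0 : Tendsto φ (𝓝 0) (𝓝 z₀) := by
    have := hφ.2.self_of_nhds.continuousAt
    rwa [ContinuousAt, hφ.1] at this
  have hX : Continuous (timeDeriv f 7) :=
    (contDiff_timeDeriv (n := 6) (m := 0) hf (by lia)).continuous
  have hb : ∀ᶠ t in 𝓝 0, ‖timeDeriv f 7 (φ t)‖ < ‖timeDeriv f 7 z₀‖ + 1 :=
    ((hX.tendsto z₀).comp hφ0).norm.eventually_lt_const (by simp)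
  obtain ⟨δ, hδ, h⟩ := Metric.eventually_nhds_iff_ball.1 (hφ.2.and hb)
  refine IsBigO.of_bound (‖timeDeriv f 7 z₀‖ + 1) ?_
  filter_upwards [Metric.ball_mem_nhds (0 : ℝ) (half_pos hδ)] with s hs
  rw [mem_ball_zero_iff, Real.norm_eq_abs] at hs
  have hmem : ∀ t, |t| ≤ |s| → s + t ∈ Metric.ball (0 : ℝ) δ := fun t ht => by
    rw [mem_ball_zero_iff, Real.norm_eq_abs]
    linarith [abs_add_le s t]
  have key := norm_sub_taylor_sum_le (n := 7) (r := |s|)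
    (u := fun k t => timeDeriv f k (φ (s + t))) (C := ‖timeDeriv f 7 z₀‖ + 1)
    (fun k hk t ht => ?_) (fun t ht => (h _ (hmem t ht)).2.le) (t := a * s) ?_
  · simp only [timeDeriv_zero, id, add_zero] at key
    have has : |a * s| ≤ |s| := by
      rw [abs_mul]
      exact mul_le_of_le_one_left (abs_nonneg _) ha
    rw [norm_pow, Real.norm_eq_abs]
    exact key.trans (mul_le_mul_of_nonneg_left (pow_le_pow_left₀ (abs_nonneg _) has 7)
      (by positivity))
  · have hd : Differentiable ℝ (timeDeriv f k) :=
      (contDiff_timeDeriv (n := 6) (m := 1) hf (by lia)).differentiable (by norm_num)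
    have h1 := hasDerivAt_comp_solution (h _ (hmem t ht)).1 (hd _)
    exact h1.comp_const_add s t
  · rw [abs_mul]
    exact mul_le_of_le_one_left (abs_nonneg _) ha

theorem IsLocalSolution.tendsto {z₀ : E} {φ : ℝ → E}
    (hφ : IsLocalSolution f z₀ φ) : Tendsto φ (𝓝[≠] 0) (𝓝 z₀) := by
  have := hφ.2.self_of_nhds.continuousAt
  rw [ContinuousAt, hφ.1] at this
  exact this.mono_left nhdsWithin_le_nhds

theorem isBigO_timeDeriv (hf : ContDiff ℝ 6 f) {z₀ : E} {φ : ℝ → E}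
    (hφ : IsLocalSolution f z₀ φ) {k : ℕ} (hk : k ≤ 7) (a : ℝ) :
    (fun s => a • timeDeriv f k (φ s)) =O[𝓝[≠] 0] fun s => s ^ 0 :=
  (isBigO_comp_of_continuous hφ.tendsto
    (contDiff_timeDeriv (n := 6) (m := 0) hf (by lia)).continuous).const_smul_left a

/-- Half the sum of the Taylor expansions of `φ(s + s)` and `φ(s - s)` about `s`: the odd
derivatives cancel, and the sixth goes into the remainder. -/
theorem evenExpansion_midpoint (hf : ContDiff ℝ 6 f) {z₀ : E} {φ : ℝ → E}
    (hφ : IsLocalSolution f z₀ φ) :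
    EvenExpansion (fun s => (1 / 2 : ℝ) • (z₀ + φ (2 * s)) - φ s) 0
      (fun s => (1 / 2 : ℝ) • timeDeriv f 2 (φ s))
      (fun s => (1 / 24 : ℝ) • timeDeriv f 4 (φ s)) := by
  refine ⟨isBigO_zero _ _, isBigO_timeDeriv hf hφ (by lia) _,
    isBigO_timeDeriv hf hφ (by lia) _, ?_⟩
  have h1 := (isBigO_solution_sub_taylor hf hφ (a := 1) (by simp)).mono
    (nhdsWithin_le_nhds (s := {0}ᶜ))
  have h2 := (isBigO_solution_sub_taylor hf hφ (a := -1) (by simp)).mono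
    (nhdsWithin_le_nhds (s := {0}ᶜ))
  have h3 := ((h1.add h2).const_smul_left (1 / 2 : ℝ)).trans (isBigO_pow_pow (show 6 ≤ 7 by lia))
  refine (h3.add (isBigO_pow_smul (n := 6) (isBigO_timeDeriv hf hφ (k := 6) (by lia)
    (1 / 720)))).congr_left fun s => ?_
  simp only [Pi.smul_apply, Finset.sum_range_succ, Finset.sum_range_zero, Nat.factorial,
    Pi.zero_apply, neg_one_mul, one_mul, add_neg_cancel, hφ.1, ← two_mul, timeDeriv_zero, id]
  push_cast
  module

/-- Half the difference of the same two expansions keeps the odd derivatives. Division by `s` costs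
one order, from `s⁷` to `s⁶`. -/
theorem evenExpansion_slope (hf : ContDiff ℝ 6 f) {z₀ : E} {φ : ℝ → E}
    (hφ : IsLocalSolution f z₀ φ) :
    EvenExpansion (fun s => s⁻¹ • (1 / 2 : ℝ) • (φ (2 * s) - z₀))
      (fun s => timeDeriv f 1 (φ s))
      (fun s => (1 / 6 : ℝ) • timeDeriv f 3 (φ s))
      (fun s => (1 / 120 : ℝ) • timeDeriv f 5 (φ s)) := by
  refine ⟨by simpa using isBigO_timeDeriv hf hφ (k := 1) (by lia) 1,
    isBigO_timeDeriv hf hφ (by lia) _, isBigO_timeDeriv hf hφ (by lia) _, ?_⟩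
  have h1 := (isBigO_solution_sub_taylor hf hφ (a := 1) (by simp)).mono
    (nhdsWithin_le_nhds (s := {0}ᶜ))
  have h2 := (isBigO_solution_sub_taylor hf hφ (a := -1) (by simp)).mono
    (nhdsWithin_le_nhds (s := {0}ᶜ))
  have h3 := (isBigO_refl (fun s : ℝ => s⁻¹) (𝓝[≠] 0)).smul
    ((h1.sub h2).const_smul_left (1 / 2 : ℝ))
  refine h3.congr' ?_ ?_
  · filter_upwards [self_mem_nhdsWithin] with s hs
    have hs : s ≠ 0 := hs
    rw [inv_smul_eq_iff₀ hs]
    simp only [Pi.smul_apply, Finset.sum_range_succ, Finset.sum_range_zero, Nat.factorial,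
      neg_one_mul, one_mul, add_neg_cancel, hφ.1, ← two_mul, timeDeriv_zero, id, smul_sub, smul_add,
      smul_inv_smul₀ hs]
    push_cast
    module
  · filter_upwards [self_mem_nhdsWithin] with s hs
    have hs : s ≠ 0 := hs
    rw [smul_eq_mul]
    field_simp

theorem integral_two_mul_sub_one_pow (k : ℕ) :
    ∫ ξ in (0 : ℝ)..1, (2 * ξ - 1) ^ k = (1 - (-1) ^ (k + 1)) / (2 * (k + 1)) := by
  rw [intervalIntegral.integral_comp_mul_sub (fun x : ℝ => x ^ k) two_ne_zero, integral_pow]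
  norm_num
  field_simp

theorem exists_norm_average_sub_le [CompleteSpace E] (hf : ContDiff ℝ 6 f) (z : E) :
    ∃ C, ∃ δ > 0, ∀ x v : E, ‖x - z‖ < δ → ‖v‖ < δ →
      ‖average f (x - v) (x + v) - (f x + (1 / 6 : ℝ) • fderiv ℝ (fderiv ℝ f) x v v
        + (1 / 120 : ℝ) • fderiv ℝ (fderiv ℝ (fderiv ℝ (fderiv ℝ f))) x v v v v)‖
        ≤ C * ‖v‖ ^ 6 := by
  obtain ⟨C, -, δ, hδ, h⟩ := exists_norm_sub_taylor_sum_le (n := 6) hf z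
  refine ⟨C, δ, hδ, fun x v hx hv => ?_⟩
  have h1 : average f (x - v) (x + v) = ∫ ξ in (0 : ℝ)..1, f (x + (2 * ξ - 1) • v) := by
    unfold average
    congr 1
    funext ξ
    congr 1
    module
  -- By symmetry about the midpoint only `k = 0, 2, 4` survive, with weights `1/(k + 1)!`.
  have h2 : ∫ ξ in (0 : ℝ)..1, ∑ k ∈ Finset.range 6,
      ((2 * ξ - 1) ^ k / (k.factorial : ℝ)) • iteratedFDeriv ℝ k f x (fun _ => v) =
      f x + (1 / 6 : ℝ) • fderiv ℝ (fderiv ℝ f) x v v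
        + (1 / 120 : ℝ) • fderiv ℝ (fderiv ℝ (fderiv ℝ (fderiv ℝ f))) x v v v v := by
    rw [intervalIntegral.integral_finsetSum fun k _ =>
      Continuous.intervalIntegrable (by fun_prop) _ _]
    simp_rw [intervalIntegral.integral_smul_const, intervalIntegral.integral_div,
      integral_two_mul_sub_one_pow]
    simp [Finset.sum_range_succ, iteratedFDeriv_two_apply, iteratedFDeriv_four_apply,
      Nat.factorial]
    norm_num
  rw [h1, ← h2, ← intervalIntegral.integral_sub]
  · refine (intervalIntegral.norm_integral_le_of_norm_le_const (C := C * ‖v‖ ^ 6)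
      fun ξ hξ => ?_).trans (by simp)
    rw [Set.uIoc_of_le zero_le_one] at hξ
    exact h x v hx hv (2 * ξ - 1) (abs_le.2 ⟨by linarith [hξ.1], by linarith [hξ.2]⟩)
  · have := hf.continuous
    exact Continuous.intervalIntegrable (by fun_prop) _ _
  · exact Continuous.intervalIntegrable (by fun_prop) _ _

/-- The matrix multiplying `h⁵ / 720` in the coefficient matrix of the method. -/
noncomputable def fifthOrderMatrix (f : E → E) (z : E) : E →L[ℝ] E :=
  (6 : ℝ) • A58 f z - A59 f z + A57 f z - A56 f z
    - (3 / 2 : ℝ) • A54 f z - (3 / 2 : ℝ) • A52 f z + (3 : ℝ) • A53 f z + (3 : ℝ) • A55 f z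

theorem contDiff_A32 (hf : ContDiff ℝ 6 f) : ContDiff ℝ 1 (A32 f) := by
  have h1 : ContDiff ℝ 1 (fderiv ℝ f) := hf.fderiv_right (by norm_num)
  exact h1.clm_comp h1

theorem contDiff_fifthOrderMatrix (hf : ContDiff ℝ 6 f) :
    ContDiff ℝ 1 (fifthOrderMatrix f) := by
  have h0 : ContDiff ℝ 1 f := hf.of_le (by norm_num)
  have h1' : ContDiff ℝ 5 (fderiv ℝ f) := hf.fderiv_right (by norm_num)
  have h2' : ContDiff ℝ 4 (fderiv ℝ (fderiv ℝ f)) := h1'.fderiv_right (by norm_num)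
  have h3' : ContDiff ℝ 3 (fderiv ℝ (fderiv ℝ (fderiv ℝ f))) := h2'.fderiv_right (by norm_num)
  have hJ : ContDiff ℝ 1 (fun z => J f z) := h1'.of_le (by norm_num)
  have h2 : ContDiff ℝ 1 (fderiv ℝ (fderiv ℝ f)) := h2'.of_le (by norm_num)
  have hB : ContDiff ℝ 1 (fun z => B f z (f z)) := h2.clm_apply h0
  have hB' : ContDiff ℝ 1 (fun z => B f z (J f z (f z))) := h2.clm_apply (hJ.clm_apply h0)
  have hT : ContDiff ℝ 1 (fun z => T f z (f z) (f z)) :=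
    ((h3'.of_le (by norm_num)).clm_apply h0).clm_apply h0
  unfold fifthOrderMatrix A58 A59 A57 A56 A54 A52 A53 A55
  exact (((((((((hJ.clm_comp (hJ.clm_comp (hJ.clm_comp hJ))).const_smul (6 : ℝ)).sub
    (hB.clm_comp hB)).add (hJ.clm_comp (hJ.clm_comp hB))).sub
    (hB.clm_comp (hJ.clm_comp hJ))).sub ((hJ.clm_comp hT).const_smul (3 / 2 : ℝ))).sub
    ((hT.clm_comp hJ).const_smul (3 / 2 : ℝ))).add
    ((hB'.clm_comp hJ).const_smul (3 : ℝ))).add ((hJ.clm_comp hB').const_smul (3 : ℝ)))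

theorem coeffMatrix_apply (f : E → E) (h : ℝ) (z w : E) :
    coeffMatrix f h z w = h • w - (h ^ 3 / 12) • J f z (J f z w)
      + (h ^ 5 / 720) • fifthOrderMatrix f z w := rfl

theorem evenExpansion_average [CompleteSpace E] (hf : ContDiff ℝ 6 f) {z₀ : E} {φ : ℝ → E}
    (hφ : IsLocalSolution f z₀ φ) :
    EvenExpansion (fun s => average f z₀ (φ (2 * s)))
      (fun s => f (φ s))
      (fun s => (1 / 2 : ℝ) • J f (φ s) (timeDeriv f 2 (φ s))
        + (1 / 6 : ℝ) • B f (φ s) (f (φ s)) (f (φ s)))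
      (fun s => (1 / 24 : ℝ) • J f (φ s) (timeDeriv f 4 (φ s))
        + (1 / 8 : ℝ) • B f (φ s) (timeDeriv f 2 (φ s)) (timeDeriv f 2 (φ s))
        + (1 / 12 : ℝ) • T f (φ s) (timeDeriv f 2 (φ s)) (f (φ s)) (f (φ s))
        + (1 / 36 : ℝ) • (B f (φ s) (f (φ s)) (timeDeriv f 3 (φ s))
          + B f (φ s) (timeDeriv f 3 (φ s)) (f (φ s)))
        + (1 / 120 : ℝ) • fderiv ℝ (fderiv ℝ (fderiv ℝ (fderiv ℝ f))) (φ s)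
          (f (φ s)) (f (φ s)) (f (φ s)) (f (φ s))) := by
  have h1 : ContDiff ℝ 5 (fderiv ℝ f) := hf.fderiv_right (by norm_num)
  have h2 : ContDiff ℝ 4 (fderiv ℝ (fderiv ℝ f)) := h1.fderiv_right (by norm_num)
  have h3 : ContDiff ℝ 3 (fderiv ℝ (fderiv ℝ (fderiv ℝ f))) := h2.fderiv_right (by norm_num)
  have hc := hφ.tendsto
  have hm := evenExpansion_midpoint hf hφ
  have he := evenExpansion_slope hf hφ
  have e0 := EvenExpansion.comp_contDiff (hf.of_le (by norm_num)) hc hm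
  have e2 := (((EvenExpansion.comp_contDiff (h2.of_le (by norm_num)) hc hm).clm_apply
    he).clm_apply he).sq_smul.const_smul (1 / 6)
  have e4 := (((EvenExpansion.pow_four_smul_fderiv_apply (h3.of_le (by norm_num)) hc hm
    he).clm_apply he).clm_apply he).clm_apply he |>.const_smul (1 / 120)
  -- The half difference is written as `s` times the slope, so that multilinearity releases the
  -- factors `s²` and `s⁴` and leaves arguments with an even expansion.
  have hrem : (fun s => average f z₀ (φ (2 * s))
      - (f (φ s + ((1 / 2 : ℝ) • (z₀ + φ (2 * s)) - φ s))
        + (1 / 6 : ℝ) • fderiv ℝ (fderiv ℝ f) (φ s + ((1 / 2 : ℝ) • (z₀ + φ (2 * s)) - φ s))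
          (s • s⁻¹ • (1 / 2 : ℝ) • (φ (2 * s) - z₀)) (s • s⁻¹ • (1 / 2 : ℝ) • (φ (2 * s) - z₀))
        + (1 / 120 : ℝ) • fderiv ℝ (fderiv ℝ (fderiv ℝ (fderiv ℝ f)))
          (φ s + ((1 / 2 : ℝ) • (z₀ + φ (2 * s)) - φ s))
          (s • s⁻¹ • (1 / 2 : ℝ) • (φ (2 * s) - z₀)) (s • s⁻¹ • (1 / 2 : ℝ) • (φ (2 * s) - z₀))
          (s • s⁻¹ • (1 / 2 : ℝ) • (φ (2 * s) - z₀)) (s • s⁻¹ • (1 / 2 : ℝ) • (φ (2 * s) - z₀))))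
      =O[𝓝[≠] 0] fun s => s ^ 6 := by
    obtain ⟨C, δ, hδ, h⟩ := exists_norm_average_sub_le hf z₀
    have hp : Tendsto (fun s => φ s + ((1 / 2 : ℝ) • (z₀ + φ (2 * s)) - φ s)) (𝓝[≠] 0)
        (𝓝 z₀) := by simpa using hc.add hm.tendsto_zero
    have hv : (fun s => s • s⁻¹ • (1 / 2 : ℝ) • (φ (2 * s) - z₀)) =O[𝓝[≠] 0]
        fun s => s := by
      simpa using isBigO_pow_smul (n := 1) he.isBigO
    have hs0 : Tendsto (fun s : ℝ => s) (𝓝[≠] 0) (𝓝 0) := nhdsWithin_le_nhds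
    have hv0 := hv.trans_tendsto hs0
    refine IsBigO.trans (IsBigO.of_bound C ?_) (hv.norm_left.pow 6)
    filter_upwards [hp.eventually (Metric.ball_mem_nhds z₀ hδ),
      hv0.eventually (Metric.ball_mem_nhds 0 hδ), self_mem_nhdsWithin] with s hs1 hs2 hs
    have hs : s ≠ 0 := hs
    have := h _ _ (mem_ball_iff_norm.1 hs1) (mem_ball_zero_iff.1 hs2)
    have ea : φ s + ((1 / 2 : ℝ) • (z₀ + φ (2 * s)) - φ s)
        - s • s⁻¹ • (1 / 2 : ℝ) • (φ (2 * s) - z₀) = z₀ := by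
      rw [smul_inv_smul₀ hs]
      module
    have eb : φ s + ((1 / 2 : ℝ) • (z₀ + φ (2 * s)) - φ s)
        + s • s⁻¹ • (1 / 2 : ℝ) • (φ (2 * s) - z₀) = φ (2 * s) := by
      rw [smul_inv_smul₀ hs]
      module
    rw [ea, eb] at this
    rw [norm_pow, norm_norm]
    exact this
  have key := ((e0.add e2).add e4).congr_of_isBigO (Y := fun s => average f z₀ (φ (2 * s)))
    (hrem.congr_left fun s => ?_)
  · convert key using 1
    · funext s
      simp
    · funext s
      simp [timeDeriv_one, J, B]
    · funext s
      simp [timeDeriv_one, J, B, T]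
      module
  · congr 1
    simp only [map_smul, _root_.smul_apply]
    module

theorem EvenExpansion.isBigO_of_eq_zero {X X₀ X₁ X₂ : ℝ → E} (h : EvenExpansion X X₀ X₁ X₂)
    (h₀ : ∀ s, X₀ s = 0) (h₁ : ∀ s, X₁ s = 0) (h₂ : ∀ s, X₂ s = 0) :
    X =O[𝓝[≠] 0] fun s => s ^ 6 := by
  simpa [h₀, h₁, h₂] using h.rem

/-- The exact solution satisfies the equation of the method up to `O(h⁷)`. -/
theorem isBigO_defect [CompleteSpace E] (hf : ContDiff ℝ 6 f) {z₀ : E} {φ : ℝ → E}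
    (hφ : IsLocalSolution f z₀ φ) :
    (fun h => φ h - (z₀ + coeffMatrix f h ((1 / 2 : ℝ) • (z₀ + φ h)) (average f z₀ (φ h))))
      =O[𝓝[≠] 0] fun h => h ^ 7 := by
  have h1 : ContDiff ℝ 5 (fderiv ℝ f) := hf.fderiv_right (by norm_num)
  have hc := hφ.tendsto
  have hm := evenExpansion_midpoint hf hφ
  have ha := evenExpansion_average hf hφ
  -- The residual divided by `s`. With `h = 2s` the weights are `h³/12 = (2/3) s³` and `h⁵/720 =
  -- (2/45) s⁵`.
  have e0 := (evenExpansion_slope hf hφ).const_smul 2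
  have hJ := EvenExpansion.comp_contDiff (h1.of_le (by norm_num)) hc hm
  have e3 := (hJ.clm_apply (hJ.clm_apply ha)).sq_smul.const_smul (2 / 3)
  have e5 := ((EvenExpansion.pow_four_smul_comp_contDiff (contDiff_fifthOrderMatrix hf) hc
    hm).clm_apply ha).const_smul (-(2 / 45))
  have key := ((e0.add (ha.const_smul (-2))).add e3).add e5 |>.isBigO_of_eq_zero
    (fun s => ?_) (fun s => ?_) (fun s => ?_)
  · have key' := (isBigO_refl (fun s : ℝ => s) (𝓝[≠] 0)).smul key
    have h2 : Tendsto (fun h : ℝ => h / 2) (𝓝[≠] 0) (𝓝[≠] 0) := by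
      refine tendsto_nhdsWithin_iff.2 ⟨?_, ?_⟩
      · have : Tendsto (fun h : ℝ => h / 2) (𝓝 0) (𝓝 (0 / 2)) :=
          (continuous_id.div_const 2).tendsto 0
        simpa using this.mono_left (nhdsWithin_le_nhds (s := {0}ᶜ))
      · filter_upwards [self_mem_nhdsWithin] with h hh
        simpa using hh
    refine (key'.comp_tendsto h2).congr' ?_ ?_ |>.trans
      ((isBigO_refl (fun h : ℝ => h ^ 7) _).const_mul_left ((1 / 2) ^ 7))
    · filter_upwards [self_mem_nhdsWithin] with h hh
      have hh : h / 2 ≠ 0 := by simpa using hh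
      simp only [Function.comp_apply, coeffMatrix_apply, J, mul_div_cancel₀ h (two_ne_zero' ℝ),
        add_sub_cancel, smul_add, smul_comm (h / 2) (2 : ℝ) ((h / 2)⁻¹ • _),
        smul_inv_smul₀ hh, _root_.smul_apply]
      module
    · refine Eventually.of_forall fun h => ?_
      simp only [Function.comp_apply, smul_eq_mul]
      ring
  · simp [timeDeriv_one]
  · simp only [Pi.zero_apply, timeDeriv_three (hf.of_le (by norm_num : (2 : WithTop ℕ∞) ≤ 6)),
      timeDeriv_two, J, B, _root_.zero_apply]
    module
  -- The order conditions for trees with five vertices. Symmetry brings equal elementary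
  -- differentials to the same form, after which the identity is linear.
  · have s2 := fderiv_fderiv_symm (hf.of_le (by norm_num : (2 : WithTop ℕ∞) ≤ 6)) (φ s)
    have s3 := fderiv_fderiv_symm (h1.of_le (by norm_num : (2 : WithTop ℕ∞) ≤ 5)) (φ s)
    have s3' := fderiv_fderiv_fderiv_symm (hf.of_le (by norm_num : (3 : WithTop ℕ∞) ≤ 6)) (φ s)
    simp only [Pi.zero_apply, timeDeriv_three (hf.of_le (by norm_num : (2 : WithTop ℕ∞) ≤ 6)),
      timeDeriv_two, timeDeriv_four (hf.of_le (by norm_num : (3 : WithTop ℕ∞) ≤ 6)),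
      timeDeriv_five (hf.of_le (by norm_num : (4 : WithTop ℕ∞) ≤ 6)), J, B, T,
      fifthOrderMatrix, A58, A59, A57, A56, A54, A52, A53, A55,
      _root_.add_apply, _root_.sub_apply, _root_.smul_apply, _root_.zero_apply,
      ContinuousLinearMap.comp_apply, map_add, map_smul]
    rw [s3 (fderiv ℝ f (φ s) (f (φ s))) (f (φ s)),
      s3' (f (φ s)) (fderiv ℝ f (φ s) (f (φ s))) (f (φ s)),
      s2 (fderiv ℝ (fderiv ℝ f) (φ s) (f (φ s)) (f (φ s))) (f (φ s)),
      s2 (fderiv ℝ f (φ s) (fderiv ℝ f (φ s) (f (φ s)))) (f (φ s))]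
    module

end Method

/-! ### Solvability of the implicit equation by contraction -/

section Method

variable {E F : Type*} [NormedAddCommGroup E] [NormedSpace ℝ E] [NormedAddCommGroup F]
  [NormedSpace ℝ F] {f : E → E}

/-- The map whose fixed points are the solutions of the implicit equation of the method. -/
noncomputable def stepMap (f : E → E) (h : ℝ) (z₀ z : E) : E :=
  z₀ + coeffMatrix f h ((1 / 2 : ℝ) • (z₀ + z)) (average f z₀ z)

theorem exists_bound_and_lipschitz {g : E → F} (hg : ContDiff ℝ 1 g) (z₀ : E) :
    ∃ M, 0 ≤ M ∧ ∃ r > 0, ∀ z ∈ Metric.ball z₀ r, ‖g z‖ ≤ M ∧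
      ∀ z' ∈ Metric.ball z₀ r, ‖g z - g z'‖ ≤ M * ‖z - z'‖ := by
  obtain ⟨K, t, ht, hK⟩ := hg.contDiffAt.exists_lipschitzOnWith (x := z₀)
  have hb : ∀ᶠ z in 𝓝 z₀, ‖g z‖ < ‖g z₀‖ + 1 :=
    hg.continuous.norm.continuousAt.eventually_lt continuousAt_const (by simp)
  obtain ⟨r, hr, h⟩ := Metric.mem_nhds_iff.1 (inter_mem ht hb)
  refine ⟨max K (‖g z₀‖ + 1), le_max_of_le_left K.2, r, hr, fun z hz =>
    ⟨(h hz).2.le.trans (le_max_right _ _), fun z' hz' => ?_⟩⟩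
  exact (hK.norm_sub_le (h hz).1 (h hz').1).trans
    (mul_le_mul_of_nonneg_right (le_max_left _ _) (norm_nonneg _))

theorem exists_stepMap_lipschitz (hf : ContDiff ℝ 6 f) (z₀ : E) :
    ∃ L, 0 ≤ L ∧ ∃ r > 0, ∀ h : ℝ, |h| ≤ 1 → ‖stepMap f h z₀ z₀ - z₀‖ ≤ L * |h| ∧
      ∀ z ∈ Metric.ball z₀ r, ∀ z' ∈ Metric.ball z₀ r,
        ‖stepMap f h z₀ z - stepMap f h z₀ z'‖ ≤ L * |h| * ‖z - z'‖ := by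
  obtain ⟨M₀, hM₀, r₀, hr₀, h₀⟩ := exists_bound_and_lipschitz (hf.of_le (by norm_num)) z₀
  obtain ⟨M₁, hM₁, r₁, hr₁, h₁⟩ := exists_bound_and_lipschitz (contDiff_A32 hf) z₀
  obtain ⟨M₂, hM₂, r₂, hr₂, h₂⟩ := exists_bound_and_lipschitz (contDiff_fifthOrderMatrix hf) z₀
  set r := min r₀ (min r₁ r₂) with hr_def
  have hr : 0 < r := by positivity
  have hs₀ : Metric.ball z₀ r ⊆ Metric.ball z₀ r₀ := Metric.ball_subset_ball (min_le_left _ _)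
  have hs₁ : Metric.ball z₀ r ⊆ Metric.ball z₀ r₁ :=
    Metric.ball_subset_ball ((min_le_right _ _).trans (min_le_left _ _))
  have hs₂ : Metric.ball z₀ r ⊆ Metric.ball z₀ r₂ :=
    Metric.ball_subset_ball ((min_le_right _ _).trans (min_le_right _ _))
  have hmid : ∀ z ∈ Metric.ball z₀ r, (1 / 2 : ℝ) • (z₀ + z) ∈ Metric.ball z₀ r := by
    intro z hz
    rw [smul_add]
    exact convex_ball z₀ r (Metric.mem_ball_self hr) hz (by norm_num) (by norm_num)
      (by norm_num)
  have hseg : ∀ z ∈ Metric.ball z₀ r, ∀ ξ ∈ Set.uIoc (0 : ℝ) 1,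
      ξ • z + (1 - ξ) • z₀ ∈ Metric.ball z₀ r := by
    intro z hz ξ hξ
    rw [Set.uIoc_of_le zero_le_one] at hξ
    exact convex_ball z₀ r hz (Metric.mem_ball_self hr) hξ.1.le (by linarith [hξ.2]) (by ring)
  have hint : ∀ z, IntervalIntegrable (fun ξ : ℝ => f (ξ • z + (1 - ξ) • z₀))
      MeasureTheory.volume 0 1 := fun z => by
    have := hf.continuous
    exact Continuous.intervalIntegrable (by fun_prop) _ _
  have havg : ∀ z ∈ Metric.ball z₀ r, ‖average f z₀ z‖ ≤ M₀ := fun z hz => by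
    simpa [average] using intervalIntegral.norm_integral_le_of_norm_le_const
      (fun ξ hξ => (h₀ _ (hs₀ (hseg z hz ξ hξ))).1)
  have havg' : ∀ z ∈ Metric.ball z₀ r, ∀ z' ∈ Metric.ball z₀ r,
      ‖average f z₀ z - average f z₀ z'‖ ≤ M₀ * ‖z - z'‖ := fun z hz z' hz' => by
    rw [average, average, ← intervalIntegral.integral_sub (hint z) (hint z')]
    refine (intervalIntegral.norm_integral_le_of_norm_le_const (C := M₀ * ‖z - z'‖)
      fun ξ hξ => ?_).trans (by simp)
    refine ((h₀ _ (hs₀ (hseg z hz ξ hξ))).2 _ (hs₀ (hseg z' hz' ξ hξ))).trans ?_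
    rw [Set.uIoc_of_le zero_le_one] at hξ
    gcongr
    rw [add_sub_add_right_eq_sub, ← smul_sub, norm_smul, Real.norm_of_nonneg hξ.1.le]
    exact mul_le_of_le_one_left (norm_nonneg _) hξ.2
  have hsmall : ∀ h : ℝ, |h| ≤ 1 → |h ^ 2 / 12| ≤ 1 ∧ |h ^ 4 / 720| ≤ 1 := fun h hh => by
    have h2 : |h| ^ 2 ≤ 1 := pow_le_one₀ (abs_nonneg _) hh
    have h4 : |h| ^ 4 ≤ 1 := pow_le_one₀ (abs_nonneg _) hh
    rw [abs_div, abs_div, abs_pow, abs_pow, abs_of_pos (by norm_num : (0 : ℝ) < 12),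
      abs_of_pos (by norm_num : (0 : ℝ) < 720)]
    constructor <;> linarith
  -- One factor `h` is taken out of the coefficient matrix; for `|h| ≤ 1` the remaining weights are
  -- at most one, so the bounds on `N` do not depend on `h`.
  set N : ℝ → E → E →L[ℝ] E := fun h z => ContinuousLinearMap.id ℝ E - (h ^ 2 / 12) • A32 f z
    + (h ^ 4 / 720) • fifthOrderMatrix f z with hN
  have hstep : ∀ h z, stepMap f h z₀ z =
      z₀ + h • N h ((1 / 2 : ℝ) • (z₀ + z)) (average f z₀ z) := fun h z => by
    simp only [stepMap, coeffMatrix_apply, hN, _root_.add_apply, _root_.sub_apply,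
      _root_.smul_apply, ContinuousLinearMap.id_apply, A32, ContinuousLinearMap.comp_apply]
    module
  have hN1 : ∀ h : ℝ, |h| ≤ 1 → ∀ z ∈ Metric.ball z₀ r, ‖N h z‖ ≤ 1 + M₁ + M₂ := by
    intro h hh z hz
    refine (norm_add_le _ _).trans (add_le_add ((norm_sub_le _ _).trans (add_le_add
      ContinuousLinearMap.norm_id_le ?_)) ?_) <;> rw [norm_smul]
    · exact (mul_le_of_le_one_left (norm_nonneg _) (hsmall h hh).1).trans (h₁ z (hs₁ hz)).1
    · exact (mul_le_of_le_one_left (norm_nonneg _) (hsmall h hh).2).trans (h₂ z (hs₂ hz)).1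
  have hN2 : ∀ h : ℝ, |h| ≤ 1 → ∀ z ∈ Metric.ball z₀ r, ∀ z' ∈ Metric.ball z₀ r,
      ‖N h z - N h z'‖ ≤ (M₁ + M₂) * ‖z - z'‖ := by
    intro h hh z hz z' hz'
    have e : N h z - N h z' = -((h ^ 2 / 12) • (A32 f z - A32 f z'))
        + (h ^ 4 / 720) • (fifthOrderMatrix f z - fifthOrderMatrix f z') := by
      simp only [hN]
      module
    rw [e, add_mul]
    refine (norm_add_le _ _).trans (add_le_add ?_ ?_)
    · rw [norm_neg, norm_smul]
      exact (mul_le_of_le_one_left (norm_nonneg _) (hsmall h hh).1).trans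
        ((h₁ z (hs₁ hz)).2 z' (hs₁ hz'))
    · rw [norm_smul]
      exact (mul_le_of_le_one_left (norm_nonneg _) (hsmall h hh).2).trans
        ((h₂ z (hs₂ hz)).2 z' (hs₂ hz'))
  refine ⟨2 * (1 + M₁ + M₂) * M₀, by positivity, r, hr, fun h hh => ⟨?_, ?_⟩⟩
  · have hz := Metric.mem_ball_self (x := z₀) hr
    rw [hstep, add_sub_cancel_left, norm_smul, Real.norm_eq_abs, mul_comm]
    refine mul_le_mul_of_nonneg_right ?_ (abs_nonneg _)
    refine ((N h _).le_of_opNorm_le_of_le (hN1 h hh _ (hmid _ hz)) (havg _ hz)).trans ?_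
    nlinarith [mul_nonneg (by positivity : 0 ≤ 1 + M₁ + M₂) hM₀]
  · intro z hz z' hz'
    have e : stepMap f h z₀ z - stepMap f h z₀ z' =
        h • ((N h ((1 / 2 : ℝ) • (z₀ + z)) - N h ((1 / 2 : ℝ) • (z₀ + z'))) (average f z₀ z)
          + N h ((1 / 2 : ℝ) • (z₀ + z')) (average f z₀ z - average f z₀ z')) := by
      rw [hstep, hstep]
      simp only [_root_.sub_apply, map_sub]
      module
    have e2 : ‖(1 / 2 : ℝ) • (z₀ + z) - (1 / 2 : ℝ) • (z₀ + z')‖ = 1 / 2 * ‖z - z'‖ := by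
      rw [← smul_sub, add_sub_add_left_eq_sub, norm_smul]
      norm_num
    have b1 := (N h ((1 / 2 : ℝ) • (z₀ + z)) - N h ((1 / 2 : ℝ) • (z₀ + z'))).le_of_opNorm_le_of_le
      (hN2 h hh _ (hmid z hz) _ (hmid z' hz')) (havg z hz)
    have b2 := (N h ((1 / 2 : ℝ) • (z₀ + z'))).le_of_opNorm_le_of_le
      (hN1 h hh _ (hmid z' hz')) (havg' z hz z' hz')
    rw [e2] at b1
    rw [e, norm_smul, Real.norm_eq_abs]
    calc _ ≤ |h| * ((M₁ + M₂) * (1 / 2 * ‖z - z'‖) * M₀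
          + (1 + M₁ + M₂) * (M₀ * ‖z - z'‖)) :=
        mul_le_mul_of_nonneg_left ((norm_add_le _ _).trans (add_le_add b1 b2)) (abs_nonneg _)
      _ ≤ |h| * ((1 + M₁ + M₂) * (M₀ * ‖z - z'‖) + (1 + M₁ + M₂) * (M₀ * ‖z - z'‖)) := by
        refine mul_le_mul_of_nonneg_left ?_ (abs_nonneg _)
        have : 0 ≤ M₀ * ‖z - z'‖ := by positivity
        nlinarith [mul_nonneg (add_nonneg hM₁ hM₂) this]
      _ = _ := by ring

/-- The contraction principle runs on the closed ball of radius `r/2`, which is complete and, since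
`r/4 + r/4 = r/2`, invariant. Uniqueness in the larger open ball follows directly from the
contraction estimate. -/
theorem exists_unique_fixedPoint_ball {E : Type*} [NormedAddCommGroup E] [CompleteSpace E]
    {S : E → E} {z₀ : E} {r : ℝ}
    (hr : 0 < r) (h₀ : ‖S z₀ - z₀‖ ≤ r / 4)
    (hS : ∀ z ∈ Metric.ball z₀ r, ∀ z' ∈ Metric.ball z₀ r, ‖S z - S z'‖ ≤ 1 / 2 * ‖z - z'‖) :
    ∃ w ∈ Metric.ball z₀ r, w = S w ∧ ∀ z ∈ Metric.ball z₀ r, z = S z → z = w := by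
  have hsub : Metric.closedBall z₀ (r / 2) ⊆ Metric.ball z₀ r :=
    Metric.closedBall_subset_ball (by linarith)
  have hmem : z₀ ∈ Metric.closedBall z₀ (r / 2) := Metric.mem_closedBall_self (by linarith)
  have hmaps : Set.MapsTo S (Metric.closedBall z₀ (r / 2)) (Metric.closedBall z₀ (r / 2)) := by
    intro z hz
    have h1 := hS z (hsub hz) z₀ (hsub hmem)
    rw [mem_closedBall_iff_norm] at hz ⊢
    calc ‖S z - z₀‖ ≤ ‖S z - S z₀‖ + ‖S z₀ - z₀‖ := norm_sub_le_norm_sub_add_norm_sub _ _ _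
      _ ≤ r / 2 := by linarith
  have hcontr : ContractingWith (1 / 2) (hmaps.restrict S _ _) := by
    refine ⟨by rw [← NNReal.coe_lt_coe]; norm_num, LipschitzWith.of_dist_le_mul fun x y => ?_⟩
    have := hS x (hsub x.2) y (hsub y.2)
    simpa [Subtype.dist_eq, dist_eq_norm] using this
  obtain ⟨w, hw, hfix, -⟩ := hcontr.exists_fixedPoint' Metric.isClosed_closedBall.isComplete
    hmaps hmem (edist_ne_top _ _)
  refine ⟨w, hsub hw, hfix.symm, fun z hz hz' => ?_⟩
  have h1 := hS z hz w (hsub hw)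
  rw [← hz', hfix.eq] at h1
  exact sub_eq_zero.1 (norm_le_zero_iff.1 (by linarith))

end Method

end SixthOrderAVF

/-! ### The order-six theorem -/

theorem theorem4p3 (n : ℕ)
    (f : EuclideanSpace ℝ (Fin n) → EuclideanSpace ℝ (Fin n)) (hf : ContDiff ℝ 6 f)
    (z₀ : EuclideanSpace ℝ (Fin n)) :
    (∃ φ : ℝ → EuclideanSpace ℝ (Fin n), SixthOrderAVF.IsLocalSolution f z₀ φ) ∧
    ∃ r > (0 : ℝ), ∃ h₀ > (0 : ℝ), ∃ Φ : ℝ → EuclideanSpace ℝ (Fin n),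
      (∀ h : ℝ, |h| < h₀ →
        Φ h ∈ Metric.ball z₀ r ∧ SixthOrderAVF.IsStep f h z₀ (Φ h) ∧
        ∀ z ∈ Metric.ball z₀ r, SixthOrderAVF.IsStep f h z₀ z → z = Φ h) ∧
      ∀ φ : ℝ → EuclideanSpace ℝ (Fin n), SixthOrderAVF.IsLocalSolution f z₀ φ →
        (fun h : ℝ => Φ h - φ h) =O[𝓝 0] (fun h : ℝ => h ^ 7) := by
  constructor
  · have hf1 : ContDiffAt ℝ 1 f z₀ := hf.contDiffAt.of_le (by norm_num)
    obtain ⟨φ, h0, ε, hε, hφ⟩ :=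
      hf1.exists_forall_mem_closedBall_exists_eq_forall_mem_Ioo_hasDerivAt₀ 0
    exact ⟨φ, h0, eventually_of_mem (Ioo_mem_nhds (by linarith) (by linarith)) hφ⟩
  obtain ⟨L, hL, r, hr, hstep⟩ := SixthOrderAVF.exists_stepMap_lipschitz hf z₀
  -- `L + 1` in place of `L` avoids a zero denominator.
  set h₀ := min 1 (min (1 / (2 * (L + 1))) (r / (4 * (L + 1)))) with hh₀
  have h₀pos : 0 < h₀ := by positivity
  have hsmall : ∀ h : ℝ, |h| < h₀ → |h| ≤ 1 ∧ L * |h| ≤ 1 / 2 ∧ L * |h| ≤ r / 4 := by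
    intro h hh
    rw [hh₀, lt_min_iff, lt_min_iff, lt_div_iff₀ (by positivity), lt_div_iff₀ (by positivity)] at hh
    have := abs_nonneg h
    refine ⟨hh.1.le, ?_, ?_⟩ <;> nlinarith [hh.2.1, hh.2.2]
  have hlip : ∀ h : ℝ, |h| < h₀ → ∀ z ∈ Metric.ball z₀ r, ∀ z' ∈ Metric.ball z₀ r,
      ‖SixthOrderAVF.stepMap f h z₀ z - SixthOrderAVF.stepMap f h z₀ z'‖ ≤ 1 / 2 * ‖z - z'‖ :=
    fun h hh z hz z' hz' => ((hstep h (hsmall h hh).1).2 z hz z' hz').trans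
      (mul_le_mul_of_nonneg_right (hsmall h hh).2.1 (norm_nonneg _))
  have hfix : ∀ h : ℝ, |h| < h₀ → ∃ w ∈ Metric.ball z₀ r, w = SixthOrderAVF.stepMap f h z₀ w ∧
      ∀ z ∈ Metric.ball z₀ r, z = SixthOrderAVF.stepMap f h z₀ z → z = w := fun h hh =>
    SixthOrderAVF.exists_unique_fixedPoint_ball hr
      ((hstep h (hsmall h hh).1).1.trans (hsmall h hh).2.2) (hlip h hh)
  choose! Φ hΦ using hfix
  refine ⟨r, hr, h₀, h₀pos, Φ, hΦ, fun φ hφ => ?_⟩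
  -- The expansions divide by `s`, so `h = 0` is separate: there `h ^ 7` vanishes and the two values
  -- must agree exactly.
  rw [← nhdsNE_sup_pure, isBigO_sup, isBigO_pure]
  constructor
  -- With `S` the step map, `‖Φ - φ‖ ≤ ‖S Φ - S φ‖ + ‖S φ - φ‖ ≤ ‖Φ - φ‖/2 + ‖S φ - φ‖`, whence the
  -- constant 2.
  · refine IsBigO.trans (IsBigO.of_bound 2 ?_) (SixthOrderAVF.isBigO_defect hf hφ)
    have hball : ∀ᶠ h : ℝ in 𝓝[≠] 0, |h| < h₀ := by
      have := nhdsWithin_le_nhds (s := {0}ᶜ) (Metric.ball_mem_nhds (0 : ℝ) h₀pos)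
      filter_upwards [this] with h hh
      simpa using hh
    filter_upwards [hball, hφ.tendsto (Metric.ball_mem_nhds z₀ hr)] with h hh hφh
    obtain ⟨hw, hw', -⟩ := hΦ h hh
    have h1 := hlip h hh _ hw _ hφh
    rw [← hw'] at h1
    have h2 := norm_sub_le_norm_sub_add_norm_sub (Φ h) (SixthOrderAVF.stepMap f h z₀ (φ h)) (φ h)
    rw [norm_sub_rev (SixthOrderAVF.stepMap f h z₀ (φ h)) (φ h)] at h2
    change _ ≤ 2 * ‖φ h - SixthOrderAVF.stepMap f h z₀ (φ h)‖
    linarith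
  · intro _
    have h1 := (hΦ 0 (by simpa using h₀pos)).2.1
    rw [h1, hφ.1]
    simp [SixthOrderAVF.stepMap, SixthOrderAVF.coeffMatrix]
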